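/- Let $\mathbb{T}^+$ be $\{0,1,2,\dots\}$ or $[0,\infty)$, let $(\Omega,\mathcal F,(\mathcal F_t)_{t\in\mathbb{T}^+},\mathbb P)$ be a filtered probability space, $\mathcal F_+=\sigma(\mathcal F_t:t\in\mathbb{T}^+)$, and let $(\theta^t)_{t\in\mathbb{T}^+}$ be $\mathbb P$-preserving measurable maps of $\Omega$ with $\theta^0=\mathrm{id}$, $\theta^{s+t}=\theta^t\circ\theta^s$, such that for all $s,t$ the map $\theta^t$ is $(\mathcal F_{s+t},\mathcal F_s)$-measurable and $\mathcal F_t$ is independent of $(\theta^t)^{-1}\mathcal F_+$. Assume that every $\theta^t$ is an automorphism of the measurable space $(\Omega,\mathcal F)$, and that $\mathbb P$ is ergodic: each $E\in\mathcal F$ with $\mathbb P((\theta^t)^{-1}E\,\triangle\,E)=0$ for all $t\in\mathbb{T}^+$ has $\mathbb P(E)\in\{0,1\}$. Put $\mathcal F_-=\sigma(\theta^t E: t\in\mathbb{T}^+,\,E\in\mathcal F_t)$. Let $\mathbb S^1=\mathbb R/\mathbb Z$ with its usual metric, and let $\varphi(t,\omega)$ ($t\in\mathbb{T}^+$, $\omega\in\Omega$)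 be orientation-preserving homeomorphisms of $\mathbb S^1$ such that $(\omega,x)\mapsto\varphi(t,\omega)x$ is $\mathcal F_t\otimes\mathcal B(\mathbb S^1)$-measurable for each $t$; $\varphi(0,\omega)=\mathrm{id}$; $\varphi(s+t,\omega)=\varphi(t,\theta^s\omega)\circ\varphi(s,\omega)$; and, for each $\omega$, whenever $x_n\to x$, one has $\varphi(t_n,\omega)x_n\to\varphi(t,\omega)x$ if $(t_n)$ decreases to $t$, and $\varphi(t_n,\omega)x_n\to\varphi_-(t,\omega,x)$ if $(t_n)$ is strictly increasing with limit $t$, for some function $\varphi_-:\mathbb{T}^+\times\Omega\times\mathbb S^1\to\mathbb S^1$. A point $s\in\mathbb S^1$ is a crack point of $\omega$ if $\operatorname{diam}(\varphi(t,\omega)A)\to0$ as $t\to\infty$ for every $A\subset\mathbb S^1$ with $s\notin\bar A$. A measurable $q:\Omega\to\mathbb S^1$ is a random fixed point if for each $t$, $\varphi(t,\omega)q(\omega)=q(\theta^t\omega)$ for $\mathbb P$-almost all $\omega$, and $\boldsymbol\delta_q$ denotes the law of $\omega\mapsto(\omega,q(\omega))$ under $\mathbb P$. An invariant measure of $\varphi$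 is a probability measure on $(\Omega\times\mathbb S^1,\mathcal F\otimes\mathcal B(\mathbb S^1))$ with marginal $\mathbb P$ on $\Omega$ that is invariant under $(\omega,x)\mapsto(\theta^t\omega,\varphi(t,\omega)x)$ for all $t\in\mathbb{T}^+$. Theorem. Suppose that $\mathbb P$-almost every $\omega$ has a crack point, and let $r:\Omega\to\mathbb S^1$ be a measurable function such that $r(\omega)$ is the crack point of $\omega$ for every $\omega$ that has one. Then $r$ is a random fixed point that agrees $\mathbb P$-almost surely with an $\mathcal F_+$-measurable function, and either (A) $\boldsymbol\delta_r$ is the only invariant measure of $\varphi$; or (B) there is an $\mathcal F_-$-measurable random fixed point $a:\Omega\to\mathbb S^1$ with $a(\omega)\ne r(\omega)$ for $\mathbb P$-almost every $\omega$, such that the set of invariant measures of $\varphi$ is $\{\lambda\boldsymbol\delta_r+(1-\lambda)\boldsymbol\delta_a:\lambda\in[0,1]\}$. -/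

import Mathlib

open MeasureTheory ProbabilityTheory Filter Topology
open scoped NNReal

namespace CircleRDS

/-- The two possible sets of times, as additive submonoids of `[0, ∞)`:
`{0, 1, 2, …}` and `[0, ∞)` itself. -/
def IsTimeSet (T : AddSubmonoid ℝ≥0) : Prop :=
  T = AddMonoidHom.mrange (Nat.castAddMonoidHom ℝ≥0) ∨ T = ⊤

section Noise

variable {Ω : Type*} {m : MeasurableSpace Ω} {T : AddSubmonoid ℝ≥0}

/-- The future σ-algebra, generated by all the `ℱ t`. -/
abbrev futureSigma (ℱ : Filtration T m) : MeasurableSpace Ω := ⨆ t, ℱ t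

/-- The past σ-algebra, generated by the images `θ t '' E` with `E ∈ ℱ t`. -/
abbrev pastSigma (ℱ : Filtration T m) (θ : T → Ω → Ω) : MeasurableSpace Ω :=
  MeasurableSpace.generateFrom
    {S | ∃ (t : T) (E : Set Ω), MeasurableSet[ℱ t] E ∧ S = θ t '' E}

/-- Stationary memoryless noise: a measure-preserving semigroup `θ` on a filtered space, where
`ℱ t` is the information available between time `0` and time `t`. -/
structure IsMemorylessNoise (P : Measure Ω) (ℱ : Filtration T m) (θ : T → Ω → Ω) : Prop where
  measurePreserving : ∀ t, MeasurePreserving (θ t) P P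
  map_zero : θ 0 = id
  map_add : ∀ s t, θ (s + t) = θ t ∘ θ s
  shift_measurable : ∀ s t, Measurable[ℱ (s + t), ℱ s] (θ t)
  indep : ∀ t, Indep (ℱ t) ((futureSigma ℱ).comap (θ t)) P

/-- Two-sided time: every `θ t` is an automorphism of the measurable space `Ω`. -/
def IsTwoSided {Ω : Type*} [MeasurableSpace Ω] (θ : T → Ω → Ω) : Prop :=
  ∀ t, ∃ e : Ω ≃ᵐ Ω, ∀ ω, e ω = θ t ω

/-- Ergodicity of `P` for the semigroup `θ`: measurable sets that are invariant modulo null sets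
under every `θ t` are trivial. -/
def IsErgodicFlow (P : Measure Ω) (θ : T → Ω → Ω) : Prop :=
  ∀ E : Set Ω, MeasurableSet E → (∀ t, θ t ⁻¹' E =ᵐ[P] E) → P E = 0 ∨ P E = 1

end Noise

/-- A homeomorphism of the circle `ℝ / ℤ` preserves orientation if it has an increasing lift. -/
def OrientationPreserving (f : UnitAddCircle ≃ₜ UnitAddCircle) : Prop :=
  ∃ F : ℝ → ℝ, Continuous F ∧ StrictMono F ∧ (∀ x, F (x + 1) = F x + 1) ∧
    ∀ x : ℝ, ((F x : ℝ) : UnitAddCircle) = f (x : UnitAddCircle)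

section RDS

variable {Ω : Type*} {m : MeasurableSpace Ω} {T : AddSubmonoid ℝ≥0}

/-- `φ` is an invertible càdlàg random dynamical system on the circle over the noise `θ`. -/
structure IsRDS (ℱ : Filtration T m) (θ : T → Ω → Ω)
    (φ : T → Ω → UnitAddCircle ≃ₜ UnitAddCircle) : Prop where
  orientationPreserving : ∀ t ω, OrientationPreserving (φ t ω)
  measurable : ∀ t, Measurable[(ℱ t).prod inferInstance]
    (fun p : Ω × UnitAddCircle => φ t p.1 p.2)
  map_zero : ∀ ω x, φ 0 ω x = x
  cocycle : ∀ s t ω x, φ (s + t) ω x = φ t (θ s ω) (φ s ω x)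
  right_continuous : ∀ (ω : Ω) (t : T) (x : UnitAddCircle) (u : ℕ → T) (y : ℕ → UnitAddCircle),
    Antitone u → Tendsto u atTop (𝓝 t) → Tendsto y atTop (𝓝 x) →
      Tendsto (fun n => φ (u n) ω (y n)) atTop (𝓝 (φ t ω x))
  left_limits : ∃ φ' : T → Ω → UnitAddCircle → UnitAddCircle,
    ∀ (ω : Ω) (t : T) (x : UnitAddCircle) (u : ℕ → T) (y : ℕ → UnitAddCircle),
      StrictMono u → Tendsto u atTop (𝓝 t) → Tendsto y atTop (𝓝 x) →
        Tendsto (fun n => φ (u n) ω (y n)) atTop (𝓝 (φ' t ω x))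

/-- `s` is a crack point of the sample point `ω`. -/
def IsCrackPoint (φ : T → Ω → UnitAddCircle ≃ₜ UnitAddCircle) (ω : Ω) (s : UnitAddCircle) : Prop :=
  ∀ A : Set UnitAddCircle, s ∉ closure A →
    Tendsto (fun t : T => Metric.diam (φ t ω '' A)) atTop (𝓝 0)

/-- The set of contractive sample points, i.e. those that admit a crack point. -/
def contractiveSet (φ : T → Ω → UnitAddCircle ≃ₜ UnitAddCircle) : Set Ω :=
  {ω | ∃ s, IsCrackPoint φ ω s}

/-- A measurable `q : Ω → ℝ / ℤ` is a random fixed point of `φ`. -/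
structure IsRandomFixedPoint (P : Measure Ω) (θ : T → Ω → Ω)
    (φ : T → Ω → UnitAddCircle ≃ₜ UnitAddCircle) (q : Ω → UnitAddCircle) : Prop where
  measurable : Measurable q
  fixed : ∀ t, ∀ᵐ ω ∂P, φ t ω (q ω) = q (θ t ω)

/-- The skew product `Θ t (ω, x) = (θ t ω, φ t ω x)`. -/
def skewProduct (θ : T → Ω → Ω) (φ : T → Ω → UnitAddCircle ≃ₜ UnitAddCircle) (t : T)
    (p : Ω × UnitAddCircle) : Ω × UnitAddCircle :=
  (θ t p.1, φ t p.1 p.2)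

/-- `μ` is an invariant (probability) measure of `φ`: it has marginal `P` on `Ω` and is invariant
under the skew product. -/
structure IsInvariantMeasure (P : Measure Ω) (θ : T → Ω → Ω)
    (φ : T → Ω → UnitAddCircle ≃ₜ UnitAddCircle) (μ : Measure (Ω × UnitAddCircle)) : Prop where
  isProbabilityMeasure : IsProbabilityMeasure μ
  compatible : ∀ E : Set Ω, MeasurableSet E → μ (E ×ˢ Set.univ) = P E
  invariant : ∀ t, MeasurePreserving (skewProduct θ φ t) μ μ

/-- The random Dirac mass `δ_q`: the law of `ω ↦ (ω, q ω)`. -/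
noncomputable def randomDirac (P : Measure Ω) (q : Ω → UnitAddCircle) :
    Measure (Ω × UnitAddCircle) :=
  P.map (fun ω => (ω, q ω))

end RDS

end CircleRDS

namespace CircleRDS

/-! ### Diameters of subsets of the circle -/

section Geometry

/-! A crack point is unique, so the cocycle property carries crack points to crack points and `r` is
a random fixed point; `exists_measurable_eq_crackPoint` reads it off future trajectories.

Let `G` be the graph of `r`. It is invariant modulo every invariant measure `μ`, and ergodicity
forces `μ.restrict G` to have marginal `μ G • P`. Hence `μ` is `μ G • δ_r` plus a part on `Gᶜ`
which, if nonzero, normalizes to an invariant measure not charging `r`.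

There is at most one such measure (`ae_eq_of_invariant_off_crackPoint`). Couple two of them
independently over each `ω`: the mean distance between the two points is constant in time by
invariance, yet tends to `0` because points off the crack point are attracted to each other. So the
points coincide, and the fibres are the same Dirac mass at some `a ω`. Finally `a` is a limit of
trajectories started from a fixed point in the remote past, which makes it past-measurable. -/

theorem not_diam_lt_of_union_eq_univ {A B : Set UnitAddCircle} (h : A ∪ B = Set.univ)
    (hA : Metric.diam A < 1 / 3) (hB : Metric.diam B < 1 / 3) : False := by
  have key : ∀ C : Set UnitAddCircle, Metric.diam C < 1 / 3 → ∀ x ∈ C, ∀ y ∈ C,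
      dist x y < 1 / 3 := fun C hC x hx y hy =>
    (Metric.dist_le_diam_of_mem Metric.isBounded_of_compactSpace hx hy).trans_lt hC
  -- The points `0`, `1/3`, `2/3` are pairwise at distance `1/3`, and two of them lie in the same
  -- set.
  have r1 : round (1 / 3 : ℝ) = 0 := by rw [round_eq_zero_iff]; constructor <;> norm_num
  have r2 : round (2 / 3 : ℝ) = 1 := by
    rw [round_eq, Int.floor_eq_iff]; constructor <;> norm_num
  have d1 : dist ((1 / 3 : ℝ) : UnitAddCircle) ((0 : ℝ) : UnitAddCircle) = 1 / 3 := by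
    rw [dist_eq_norm, ← AddCircle.coe_sub, UnitAddCircle.norm_eq, sub_zero, r1]; norm_num
  have d2 : dist ((2 / 3 : ℝ) : UnitAddCircle) ((0 : ℝ) : UnitAddCircle) = 1 / 3 := by
    rw [dist_eq_norm, ← AddCircle.coe_sub, UnitAddCircle.norm_eq, sub_zero, r2]; norm_num
  have d3 : dist ((2 / 3 : ℝ) : UnitAddCircle) ((1 / 3 : ℝ) : UnitAddCircle) = 1 / 3 := by
    rw [dist_eq_norm, ← AddCircle.coe_sub, UnitAddCircle.norm_eq,
      show (2 / 3 - 1 / 3 : ℝ) = 1 / 3 by norm_num, r1]; norm_num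
  have hm : ∀ x : UnitAddCircle, x ∈ A ∨ x ∈ B := fun x => by
    rw [← Set.mem_union, h]; trivial
  have kA := key A hA
  have kB := key B hB
  rcases hm ((0 : ℝ) : UnitAddCircle) with h0 | h0 <;>
  rcases hm ((1 / 3 : ℝ) : UnitAddCircle) with h1 | h1 <;>
  rcases hm ((2 / 3 : ℝ) : UnitAddCircle) with h2 | h2 <;>
  first
    | exact (kA _ h1 _ h0).ne d1
    | exact (kA _ h2 _ h0).ne d2
    | exact (kA _ h2 _ h1).ne d3
    | exact (kB _ h1 _ h0).ne d1
    | exact (kB _ h2 _ h0).ne d2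
    | exact (kB _ h2 _ h1).ne d3

theorem diam_image_le_diam_image_inter (f : UnitAddCircle ≃ₜ UnitAddCircle)
    {U D : Set UnitAddCircle} (hU : IsOpen U) (hD : Dense D) :
    Metric.diam (f '' U) ≤ Metric.diam (f '' (U ∩ D)) := by
  rw [← Metric.diam_closure (f '' (U ∩ D))]
  refine Metric.diam_mono ?_ Metric.isBounded_of_compactSpace
  exact (Set.image_mono (hD.open_subset_closure_inter hU)).trans
    (image_closure_subset_closure_image f.continuous)

end Geometry

theorem measurable_limUnder {Ω : Type*} {m : MeasurableSpace Ω} {f : ℕ → Ω → UnitAddCircle}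
    (hf : ∀ n, Measurable (f n)) : Measurable fun ω => limUnder atTop fun n => f n ω :=
  (StronglyMeasurable.limUnder fun n => (hf n).stronglyMeasurable).measurable

/-! ### Crack points: uniqueness, equivariance, measurability -/

section Crack

variable {Ω : Type*} {m : MeasurableSpace Ω} {T : AddSubmonoid ℝ≥0}
  {φ : T → Ω → UnitAddCircle ≃ₜ UnitAddCircle} {θ : T → Ω → Ω} {ℱ : Filtration T m}

theorem IsTimeSet.exists_tendsto_atTop (hT : IsTimeSet T) :
    ∃ τ : ℕ → T, Tendsto τ atTop atTop := by
  have h : ∀ n : ℕ, (n : ℝ≥0) ∈ T := by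
    intro n
    rcases hT with rfl | rfl
    · exact ⟨n, rfl⟩
    · trivial
  refine ⟨fun n => ⟨n, h n⟩, tendsto_atTop_atTop.2 fun b => ?_⟩
  obtain ⟨N, hN⟩ := exists_nat_ge (b : ℝ≥0)
  refine ⟨N, fun n hn => ?_⟩
  change (b : ℝ≥0) ≤ n
  exact hN.trans (by exact_mod_cast hn)

/-- Complements of disjoint neighbourhoods of two crack points would cover the circle, yet both
would have small images at a common late time. -/
theorem IsCrackPoint.eq {ω : Ω} {s s' : UnitAddCircle} (h : IsCrackPoint φ ω s)
    (h' : IsCrackPoint φ ω s') : s = s' := by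
  by_contra hne
  obtain ⟨U, V, hU, hV, hsU, hsV, hd⟩ := t2_separation hne
  have h1 := h Uᶜ (by rw [hU.isClosed_compl.closure_eq]; exact fun hx => hx hsU)
  have h2 := h' Vᶜ (by rw [hV.isClosed_compl.closure_eq]; exact fun hx => hx hsV)
  obtain ⟨t, ht1, ht2⟩ := ((h1.eventually_lt_const (show (0 : ℝ) < 1 / 3 by norm_num)).and
    (h2.eventually_lt_const (show (0 : ℝ) < 1 / 3 by norm_num))).exists
  refine not_diam_lt_of_union_eq_univ ?_ ht1 ht2
  rw [← Set.image_union, ← Set.compl_inter, hd.inter_eq, Set.compl_empty, Set.image_univ,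
    (φ t ω).surjective.range_eq]

theorem IsCrackPoint.map (hφ : IsRDS ℱ θ φ) {ω : Ω} {s : UnitAddCircle}
    (h : IsCrackPoint φ ω s) (t : T) : IsCrackPoint φ (θ t ω) (φ t ω s) := by
  intro A hA
  have h1 := h (φ t ω ⁻¹' A) (by
    rw [← (φ t ω).preimage_closure]; exact hA)
  have h2 : Tendsto (fun u : T => t + u) atTop atTop :=
    tendsto_atTop_mono (fun u => by
      change (u : ℝ≥0) ≤ (t : ℝ≥0) + u
      exact le_add_self) tendsto_id
  refine (h1.comp h2).congr fun u => ?_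
  simp only [Function.comp]
  congr 1
  have : ∀ x, φ (t + u) ω x = φ u (θ t ω) (φ t ω x) := hφ.cocycle t u ω
  simp_rw [this]
  rw [show (fun x => φ u (θ t ω) (φ t ω x)) = φ u (θ t ω) ∘ φ t ω from rfl, Set.image_comp,
    Set.image_preimage_eq _ (φ t ω).surjective]

theorem IsCrackPoint.tendsto_dist {ω : Ω} {s x y : UnitAddCircle} (h : IsCrackPoint φ ω s)
    (hx : x ≠ s) (hy : y ≠ s) :
    Tendsto (fun t => dist (φ t ω x) (φ t ω y)) atTop (𝓝 0) := by
  have := h {x, y} (by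
    rw [(Set.toFinite {x, y}).isClosed.closure_eq]
    simp [hx.symm, hy.symm])
  refine squeeze_zero (fun _ => dist_nonneg) (fun t => ?_) this
  exact Metric.dist_le_diam_of_mem Metric.isBounded_of_compactSpace
    (Set.mem_image_of_mem _ (by simp)) (Set.mem_image_of_mem _ (by simp))

theorem IsRDS.measurable_apply (hφ : IsRDS ℱ θ φ) (t : T) (x : UnitAddCircle) :
    Measurable[ℱ t] (fun ω => φ t ω x) := by
  let _ : MeasurableSpace Ω := ℱ t
  exact (hφ.measurable t).comp measurable_prodMk_right

theorem IsRDS.measurable_uncurry (hφ : IsRDS ℱ θ φ) (t : T) :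
    Measurable (fun p : Ω × UnitAddCircle => φ t p.1 p.2) :=
  (hφ.measurable t).mono (sup_le_sup_right (MeasurableSpace.comap_mono (ℱ.le t)) _) le_rfl

/-- The crack point is a measurable function of the trajectories of `φ` along any sequence of times
tending to infinity. -/
theorem exists_measurable_eq_crackPoint {m' : MeasurableSpace Ω} {τ : ℕ → T}
    (hτ : Tendsto τ atTop atTop) (hm : ∀ n x, Measurable[m'] (fun ω => φ (τ n) ω x)) :
    ∃ r' : Ω → UnitAddCircle, Measurable[m'] r' ∧ ∀ ω s, IsCrackPoint φ ω s → r' ω = s := by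
  classical
  set d : ℕ → UnitAddCircle := TopologicalSpace.denseSeq UnitAddCircle with hd_def
  have hd : DenseRange d := TopologicalSpace.denseRange_denseSeq _
  let U : ℕ → ℕ → Set UnitAddCircle := fun k j => (Metric.closedBall (d j) (1 / ((k : ℝ) + 1)))ᶜ
  have hU : ∀ k j, IsOpen (U k j) := fun k j => Metric.isClosed_closedBall.isOpen_compl
  -- Outside the ball of radius `1/(k+1)` about `d j`, the flow is eventually contracting. Testing
  -- only dense points keeps the event measurable, and `1/4 < 1/3` is enough to locate the crack
  -- point in that ball.
  let G : ℕ → ℕ → Ω → Prop := fun k j ω => ∃ N, ∀ n, N ≤ n → ∀ a b, d a ∈ U k j → d b ∈ U k j →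
    dist (φ (τ n) ω (d a)) (φ (τ n) ω (d b)) ≤ 1 / 4
  have hG : ∀ k j, MeasurableSet[m'] {ω | G k j ω} := by
    intro k j
    refine measurableSet_setOfPred.2 ?_
    refine Measurable.exists fun N => Measurable.forall fun n => Measurable.forall fun _ =>
      Measurable.forall fun a => Measurable.forall fun b => Measurable.forall fun _ =>
      Measurable.forall fun _ => ?_
    exact measurableSet_setOfPred.1 (measurableSet_le ((hm n _).dist (hm n _)) measurable_const)
  have hGmem : ∀ k j ω s, IsCrackPoint φ ω s → G k j ω →
      dist s (d j) ≤ 1 / ((k : ℝ) + 1) := by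
    rintro k j ω s hs ⟨N, hN⟩
    by_contra hlt
    have hsU : s ∈ U k j := hlt
    have h1 := (hs (U k j)ᶜ (by
      rw [(hU k j).isClosed_compl.closure_eq]; exact fun hx => hx hsU)).comp hτ
    obtain ⟨n, hn1, hn2⟩ := ((h1.eventually_lt_const (show (0 : ℝ) < 1 / 3 by norm_num)).and
      (eventually_ge_atTop N)).exists
    refine not_diam_lt_of_union_eq_univ (A := φ (τ n) ω '' U k j) ?_ ?_ hn1
    · rw [← Set.image_union, Set.union_compl_self, Set.image_univ, (φ _ ω).surjective.range_eq]
    · refine (diam_image_le_diam_image_inter _ (hU k j) hd).trans_lt ?_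
      refine (Metric.diam_le_of_forall_dist_le (C := 1 / 4) (by norm_num) ?_).trans_lt
        (by norm_num)
      rintro _ ⟨x, ⟨hx, a, rfl⟩, rfl⟩ _ ⟨y, ⟨hy, b, rfl⟩, rfl⟩
      exact hN n hn2 a b hx hy
  have hGex : ∀ k ω s, IsCrackPoint φ ω s → ∃ j, G k j ω := by
    intro k ω s hs
    obtain ⟨j, hj⟩ := hd.exists_dist_lt s (show (0 : ℝ) < 1 / ((k : ℝ) + 1) by positivity)
    refine ⟨j, ?_⟩
    have h1 := (hs (U k j) (by
      change s ∉ closure (Metric.closedBall (d j) _)ᶜ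
      rw [closure_compl]
      exact fun h => h (Metric.ball_subset_interior_closedBall hj))).comp hτ
    obtain ⟨N, hN⟩ := eventually_atTop.1
      (h1.eventually_lt_const (show (0 : ℝ) < 1 / 4 by norm_num))
    exact ⟨N, fun n hn a b ha hb => (Metric.dist_le_diam_of_mem Metric.isBounded_of_compactSpace
      (Set.mem_image_of_mem _ ha) (Set.mem_image_of_mem _ hb)).trans (hN n hn).le⟩
  -- The second alternative only makes the search total; it never occurs when `ω` has a crack point.
  let p : ℕ → ℕ → Ω → Prop := fun k j ω => G k j ω ∨ ∀ i, ¬ G k i ω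
  have hp : ∀ k ω, ∃ j, p k j ω := by
    intro k ω
    by_cases h : ∃ j, G k j ω
    · exact h.imp fun j hj => Or.inl hj
    · exact ⟨0, Or.inr (not_exists.1 h)⟩
  have hpm : ∀ k j, MeasurableSet[m'] {ω | p k j ω} := fun k j => by
    refine measurableSet_setOfPred.2 (Measurable.or (measurableSet_setOfPred.1 (hG k j)) ?_)
    exact Measurable.forall fun i => Measurable.not (measurableSet_setOfPred.1 (hG k i))
  let R : ℕ → Ω → UnitAddCircle := fun k ω => d (Nat.find (hp k ω))
  have hR : ∀ k, Measurable[m'] (R k) := fun k =>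
    Measurable.find (f := fun j _ => d j) (fun _ => measurable_const) (hpm k) (hp k)
  refine ⟨fun ω => limUnder atTop fun k => R k ω,
    measurable_limUnder hR, ?_⟩
  intro ω s hs
  refine Tendsto.limUnder_eq ?_
  rw [tendsto_iff_dist_tendsto_zero]
  refine squeeze_zero (fun _ => dist_nonneg) (fun k => ?_)
    tendsto_one_div_add_atTop_nhds_zero_nat
  rw [dist_comm]
  refine hGmem k _ ω s hs ?_
  rcases Nat.find_spec (hp k ω) with h | h
  · exact h
  · obtain ⟨j, hj⟩ := hGex k ω s hs
    exact absurd hj (h j)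

end Crack

end CircleRDS

namespace CircleRDS

variable {Ω : Type*} {m : MeasurableSpace Ω} {T : AddSubmonoid ℝ≥0} {P : Measure Ω}
  {φ : T → Ω → UnitAddCircle ≃ₜ UnitAddCircle} {θ : T → Ω → Ω} {ℱ : Filtration T m}

/-! ### Ergodicity on the base -/

section Ergodic

theorem IsTwoSided.measurableEmbedding (hA : IsTwoSided θ) (t : T) :
    MeasurableEmbedding (θ t) := by
  obtain ⟨e, he⟩ := hA t
  rw [← funext he]
  exact e.measurableEmbedding

/-- Since each `θ t` is a measurable embedding preserving both measures, the density of `ρ` is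
invariant modulo null sets, hence constant by ergodicity. -/
theorem IsErgodicFlow.eq_smul_of_invariant [IsProbabilityMeasure P] (hB : IsErgodicFlow P θ)
    (hA : IsTwoSided θ) (hθ : ∀ t, MeasurePreserving (θ t) P P) {ρ : Measure Ω}
    [IsFiniteMeasure ρ] (hρ : ρ ≪ P) (hinv : ∀ t, ρ.map (θ t) = ρ) :
    ρ = ρ Set.univ • P := by
  have h1 : ∀ t, (fun ω => ρ.rnDeriv P (θ t ω)) =ᵐ[P] ρ.rnDeriv P := by
    intro t
    have := (hA.measurableEmbedding t).rnDeriv_map ρ P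
    rwa [hinv t, (hθ t).map_eq] at this
  obtain ⟨c, hc⟩ : ∃ c, ρ.rnDeriv P =ᵐ[P] Function.const Ω c := by
    refine exists_eventuallyEq_const_of_forall_separating MeasurableSet fun U hU => ?_
    have hm : MeasurableSet (ρ.rnDeriv P ⁻¹' U) := Measure.measurable_rnDeriv ρ P hU
    rcases hB _ hm (fun t => (h1 t).preimage U) with h | h
    · exact Or.inr (measure_eq_zero_iff_ae_notMem.1 h)
    · exact Or.inl ((prob_compl_eq_zero_iff hm).2 h)
  have h2 : ρ = c • P := by
    rw [← Measure.withDensity_rnDeriv_eq ρ P hρ, withDensity_congr_ae hc]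
    exact withDensity_const c
  have h3 : ρ Set.univ = c := by rw [h2]; simp
  rw [h3]; exact h2

end Ergodic

/-! ### Graphs, invariant measures and their restrictions -/

section InvariantMeasures

theorem IsInvariantMeasure.map_fst {μ : Measure (Ω × UnitAddCircle)}
    (hμ : IsInvariantMeasure P θ φ μ) : μ.map Prod.fst = P := by
  ext E hE
  rw [Measure.map_apply measurable_fst hE, ← hμ.compatible E hE, Set.prod_univ]

theorem IsRDS.measurable_skewProduct (hφ : IsRDS ℱ θ φ) {t : T} (hθ : Measurable (θ t)) :
    Measurable (skewProduct θ φ t) :=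
  (hθ.comp measurable_fst).prodMk (hφ.measurable_uncurry t)

theorem measurableSet_graph {q : Ω → UnitAddCircle} (hq : Measurable q) :
    MeasurableSet {p : Ω × UnitAddCircle | p.2 = q p.1} :=
  measurableSet_eq_fun measurable_snd (hq.comp measurable_fst)

theorem eq_map_of_ae_eq_graph {μ : Measure (Ω × UnitAddCircle)} {q : Ω → UnitAddCircle}
    (hq : Measurable q) (h : ∀ᵐ p ∂μ, p.2 = q p.1) :
    μ = (μ.map Prod.fst).map (fun ω => (ω, q ω)) := by
  have hm : Measurable fun ω => (ω, q ω) := measurable_id.prodMk hq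
  rw [Measure.map_map hm measurable_fst]
  conv_lhs => rw [← Measure.map_id (μ := μ)]
  refine Measure.map_congr ?_
  filter_upwards [h] with p hp
  exact Prod.ext rfl hp

theorem randomDirac_congr {q q' : Ω → UnitAddCircle} (h : q =ᵐ[P] q') :
    randomDirac P q = randomDirac P q' :=
  Measure.map_congr (by filter_upwards [h] with ω hω; rw [hω])

theorem IsRandomFixedPoint.congr (hθ : ∀ t, MeasurePreserving (θ t) P P)
    {q q' : Ω → UnitAddCircle} (hq : IsRandomFixedPoint P θ φ q) (hq' : Measurable q')
    (h : q =ᵐ[P] q') : IsRandomFixedPoint P θ φ q' where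
  measurable := hq'
  fixed t := by
    filter_upwards [hq.fixed t, h, (hθ t).quasiMeasurePreserving.ae h] with ω h1 h2 h3
    rw [← h2, h1, h3]

theorem IsRandomFixedPoint.isInvariantMeasure [IsProbabilityMeasure P] (hφ : IsRDS ℱ θ φ)
    (hθ : ∀ t, MeasurePreserving (θ t) P P) {q : Ω → UnitAddCircle}
    (hq : IsRandomFixedPoint P θ φ q) : IsInvariantMeasure P θ φ (randomDirac P q) := by
  have hm : Measurable fun ω => (ω, q ω) := measurable_id.prodMk hq.measurable
  refine ⟨Measure.isProbabilityMeasure_map hm.aemeasurable, fun E hE => ?_, fun t => ?_⟩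
  · rw [randomDirac, Measure.map_apply hm (hE.prod .univ)]
    congr 1
    ext ω; simp
  · have hs := hφ.measurable_skewProduct (hθ t).measurable
    refine ⟨hs, ?_⟩
    rw [randomDirac, Measure.map_map hs hm]
    conv_rhs => rw [← (hθ t).map_eq, Measure.map_map hm (hθ t).measurable]
    refine Measure.map_congr ?_
    filter_upwards [hq.fixed t] with ω hω
    exact Prod.ext rfl hω

theorem isRandomFixedPoint_of_isInvariantMeasure {q : Ω → UnitAddCircle} (hq : Measurable q)
    (h : IsInvariantMeasure P θ φ (randomDirac P q)) : IsRandomFixedPoint P θ φ q where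
  measurable := hq
  fixed t := by
    have hm : Measurable fun ω => (ω, q ω) := measurable_id.prodMk hq
    have h1 : ∀ᵐ p ∂(randomDirac P q), p.2 = q p.1 :=
      (ae_map_iff hm.aemeasurable (measurableSet_graph hq)).2 (ae_of_all _ fun _ => rfl)
    exact ae_of_ae_map hm.aemeasurable ((h.invariant t).quasiMeasurePreserving.ae h1)

theorem IsInvariantMeasure.smul_add_smul {μ ν : Measure (Ω × UnitAddCircle)}
    (hμ : IsInvariantMeasure P θ φ μ) (hν : IsInvariantMeasure P θ φ ν) {a b : ENNReal}
    (hab : a + b = 1) : IsInvariantMeasure P θ φ (a • μ + b • ν) := by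
  have := hμ.isProbabilityMeasure
  have := hν.isProbabilityMeasure
  refine ⟨⟨by simp [hab]⟩, fun E hE => ?_, fun t => ⟨(hμ.invariant t).measurable, ?_⟩⟩
  · simp [hμ.compatible E hE, hν.compatible E hE, ← add_mul, hab]
  · rw [Measure.map_add _ _ (hμ.invariant t).measurable, Measure.map_smul, Measure.map_smul,
      (hμ.invariant t).map_eq, (hν.invariant t).map_eq]

theorem IsInvariantMeasure.measurePreserving_restrict {μ : Measure (Ω × UnitAddCircle)}
    (hμ : IsInvariantMeasure P θ φ μ) {S : Set (Ω × UnitAddCircle)} (hS : MeasurableSet S) {t : T}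
    (hinv : skewProduct θ φ t ⁻¹' S =ᵐ[μ] S) :
    MeasurePreserving (skewProduct θ φ t) (μ.restrict S) (μ.restrict S) := by
  have := (hμ.invariant t).restrict_preimage hS
  rwa [Measure.restrict_congr_set hinv] at this

variable [IsProbabilityMeasure P]

/-- The marginal of the restriction is dominated by `P` and invariant under `θ`, hence a multiple of
`P`. -/
theorem IsInvariantMeasure.map_fst_restrict (hB : IsErgodicFlow P θ)
    (hA : IsTwoSided θ) (hθ : ∀ t, MeasurePreserving (θ t) P P)
    {μ : Measure (Ω × UnitAddCircle)}
    (hμ : IsInvariantMeasure P θ φ μ) {S : Set (Ω × UnitAddCircle)} (hS : MeasurableSet S)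
    (hinv : ∀ t, skewProduct θ φ t ⁻¹' S =ᵐ[μ] S) :
    (μ.restrict S).map Prod.fst = μ S • P := by
  have := hμ.isProbabilityMeasure
  have hle : (μ.restrict S).map Prod.fst ≤ P := by
    rw [← hμ.map_fst]
    exact Measure.map_mono Measure.restrict_le_self measurable_fst
  have h := hB.eq_smul_of_invariant hA hθ (ρ := (μ.restrict S).map Prod.fst)
    hle.absolutelyContinuous (fun t => by
      rw [Measure.map_map (hθ t).measurable measurable_fst]
      change Measure.map (Prod.fst ∘ skewProduct θ φ t) _ = _
      have hp := hμ.measurePreserving_restrict hS (hinv t)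
      rw [← Measure.map_map measurable_fst hp.measurable, hp.map_eq])
  rw [h]
  congr 1
  rw [Measure.map_apply measurable_fst .univ]
  simp

theorem IsInvariantMeasure.normalized_restrict (hB : IsErgodicFlow P θ)
    (hA : IsTwoSided θ) (hθ : ∀ t, MeasurePreserving (θ t) P P)
    {μ : Measure (Ω × UnitAddCircle)}
    (hμ : IsInvariantMeasure P θ φ μ) {S : Set (Ω × UnitAddCircle)} (hS : MeasurableSet S)
    (hinv : ∀ t, skewProduct θ φ t ⁻¹' S =ᵐ[μ] S) (h0 : μ S ≠ 0) :
    IsInvariantMeasure P θ φ ((μ S)⁻¹ • μ.restrict S) := by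
  have := hμ.isProbabilityMeasure
  have hfst := hμ.map_fst_restrict hB hA hθ hS hinv
  have hcancel : (μ S)⁻¹ * μ S = 1 := ENNReal.inv_mul_cancel h0 (measure_ne_top _ _)
  refine ⟨⟨by simp [hcancel]⟩, fun E hE => ?_, fun t => ⟨(hμ.invariant t).measurable, ?_⟩⟩
  · have : (μ.restrict S) (E ×ˢ Set.univ) = μ S * P E := by
      rw [Set.prod_univ, ← Measure.map_apply measurable_fst hE, hfst]; simp
    rw [Measure.smul_apply, this, smul_eq_mul, ← mul_assoc, hcancel, one_mul]
  · rw [Measure.map_smul, (hμ.measurePreserving_restrict hS (hinv t)).map_eq]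

end InvariantMeasures

/-! ### Fibre measures and uniqueness off the crack point -/

section Disintegration

variable {ν : Measure (Ω × UnitAddCircle)}

theorem IsInvariantMeasure.exists_kernel (hν : IsInvariantMeasure P θ φ ν) :
    ∃ κ : Kernel Ω UnitAddCircle, IsMarkovKernel κ ∧ P ⊗ₘ κ = ν := by
  have := hν.isProbabilityMeasure
  refine ⟨ν.condKernel, inferInstance, ?_⟩
  have h := ν.disintegrate ν.condKernel
  rwa [Measure.fst, hν.map_fst] at h

theorem exists_measurable_ae_eq_dirac (κ : Kernel Ω UnitAddCircle)
    (h : ∀ᵐ ω ∂P, ∃ x, κ ω = Measure.dirac x) :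
    ∃ a : Ω → UnitAddCircle, Measurable a ∧ ∀ᵐ ω ∂P, κ ω = Measure.dirac (a ω) := by
  classical
  obtain ⟨D, hDP, hD, hDd⟩ := h.exists_measurable_mem
  -- Once every fibre is a Dirac mass, the atom `a` is measurable because `a ⁻¹' s` is where `κ'`
  -- gives `s` mass `1`.
  let κ' : Kernel Ω UnitAddCircle := Kernel.piecewise hD κ (Kernel.const Ω (Measure.dirac 0))
  have h' : ∀ ω, ∃ x, κ' ω = Measure.dirac x := by
    intro ω
    by_cases hω : ω ∈ D
    · obtain ⟨x, hx⟩ := hDd ω hω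
      exact ⟨x, by rw [Kernel.piecewise_apply, if_pos hω, hx]⟩
    · exact ⟨0, by rw [Kernel.piecewise_apply, if_neg hω, Kernel.const_apply]⟩
  choose a ha using h'
  refine ⟨a, fun s hs => ?_, ?_⟩
  · have : a ⁻¹' s = (fun ω => κ' ω s) ⁻¹' {1} := by
      ext ω
      simp only [Set.mem_preimage, Set.mem_singleton_iff, ha, Measure.dirac_apply' _ hs]
      exact (Set.indicator_eq_one_iff_mem ENNReal).symm
    rw [this]
    exact κ'.measurable_coe hs (measurableSet_singleton 1)
  · filter_upwards [hDP] with ω hω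
    rw [← ha, Kernel.piecewise_apply, if_pos hω]

theorem eq_dirac_of_ae_eq {β : Type*} [MeasurableSpace β] [MeasurableSingletonClass β]
    {μ : Measure β} [IsProbabilityMeasure μ] {x : β}
    (h : ∀ᵐ y ∂μ, x = y) : μ = Measure.dirac x := by
  have h1 : (id : β → β) =ᵐ[μ] fun _ => x := by filter_upwards [h] with y hy using hy.symm
  rw [← Measure.map_id (μ := μ), Measure.map_congr h1, Measure.map_const]
  simp

variable [IsProbabilityMeasure P]

theorem IsInvariantMeasure.kernel_equivariant (hφ : IsRDS ℱ θ φ) (hA : IsTwoSided θ)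
    (hθ : ∀ t, MeasurePreserving (θ t) P P) {κ : Kernel Ω UnitAddCircle} [IsMarkovKernel κ]
    (hν : IsInvariantMeasure P θ φ (P ⊗ₘ κ)) (t : T) :
    ∀ᵐ ω ∂P, κ (θ t ω) = (κ ω).map (φ t ω) := by
  have hmeas := hφ.measurable_uncurry t
  let η : Kernel Ω UnitAddCircle :=
    (Kernel.id ×ₖ κ).map (fun p : Ω × UnitAddCircle => φ t p.1 p.2)
  have : IsMarkovKernel η := Kernel.IsMarkovKernel.map _ hmeas
  have hη : ∀ ω, η ω = (κ ω).map (φ t ω) := by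
    intro ω
    ext s hs
    rw [Kernel.map_apply' _ hmeas _ hs, Kernel.id_prod_apply' _ _ (hmeas hs),
      Measure.map_apply (φ t ω).continuous.measurable hs]
    rfl
  have heq : P ⊗ₘ (κ.comap (θ t) (hθ t).measurable) = P ⊗ₘ η := by
    refine Measure.ext_prod fun {s u} hs hu => ?_
    obtain ⟨e, he⟩ := hA t
    -- Two-sided time enters here: every measurable set is a `θ t`-preimage, so the fibres
    -- themselves are equivariant and not merely their conditional averages.
    obtain ⟨s', hs', rfl⟩ : ∃ s', MeasurableSet s' ∧ s = θ t ⁻¹' s' := by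
      refine ⟨e.symm ⁻¹' s, e.symm.measurable hs, ?_⟩
      rw [← funext he, ← Set.preimage_comp]
      simp
    have h1 : (P ⊗ₘ (κ.comap (θ t) (hθ t).measurable)) ((θ t ⁻¹' s') ×ˢ u)
        = (P ⊗ₘ κ) (s' ×ˢ u) := by
      rw [Measure.compProd_apply_prod hs hu, Measure.compProd_apply_prod hs' hu]
      simp_rw [Kernel.comap_apply]
      exact ((hθ t).restrict_preimage hs').lintegral_comp (κ.measurable_coe hu)
    have h2 : (P ⊗ₘ η) ((θ t ⁻¹' s') ×ˢ u) = (P ⊗ₘ κ) (s' ×ˢ u) := by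
      rw [← (hν.invariant t).measure_preimage (hs'.prod hu).nullMeasurableSet,
        Measure.compProd_apply ((hν.invariant t).measurable (hs'.prod hu)),
        Measure.compProd_apply_prod hs hu, ← lintegral_indicator hs]
      refine lintegral_congr fun ω => ?_
      by_cases hω : ω ∈ θ t ⁻¹' s'
      · rw [Set.indicator_of_mem hω, hη, Measure.map_apply (φ t ω).continuous.measurable hu]
        congr 1
        ext x
        simp [skewProduct, Set.mem_preimage.1 hω]
      · rw [Set.indicator_of_notMem hω]
        symm
        convert measure_empty (μ := κ ω)
        ext x
        simp [skewProduct, mt Set.mem_preimage.2 hω]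
    rw [h1, h2]
  filter_upwards [Kernel.ae_eq_of_compProd_eq heq] with ω hω
  rw [← hη, ← hω, Kernel.comap_apply]

/-- Two invariant measures that do not charge the crack point have the same trivial fibres. -/
theorem ae_eq_of_invariant_off_crackPoint (hφ : IsRDS ℱ θ φ) (hA : IsTwoSided θ)
    (hθ : ∀ t, MeasurePreserving (θ t) P P) {τ : ℕ → T} (hτ : Tendsto τ atTop atTop)
    {r : Ω → UnitAddCircle} (hrc : ∀ᵐ ω ∂P, IsCrackPoint φ ω (r ω))
    {κ κ' : Kernel Ω UnitAddCircle} [IsMarkovKernel κ] [IsMarkovKernel κ']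
    (hκ : IsInvariantMeasure P θ φ (P ⊗ₘ κ)) (hκ' : IsInvariantMeasure P θ φ (P ⊗ₘ κ'))
    (h : ∀ᵐ p ∂(P ⊗ₘ κ), p.2 ≠ r p.1) (h' : ∀ᵐ p ∂(P ⊗ₘ κ'), p.2 ≠ r p.1) :
    ∀ᵐ ω ∂P, ∀ᵐ x ∂(κ ω), ∀ᵐ y ∂(κ' ω), x = y := by
  have hmeas : ∀ t, Measurable fun q : Ω × UnitAddCircle × UnitAddCircle =>
      edist (φ t q.1 q.2.1) (φ t q.1 q.2.2) := fun t =>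
    ((hφ.measurable_uncurry t).comp
      (measurable_fst.prodMk (measurable_fst.comp measurable_snd))).edist ((hφ.measurable_uncurry t).comp
      (measurable_fst.prodMk (measurable_snd.comp measurable_snd)))
  have hed : Measurable fun z : UnitAddCircle × UnitAddCircle => edist z.1 z.2 :=
    measurable_fst.edist measurable_snd
  -- The fibrewise independent coupling of the two measures.
  set M := P ⊗ₘ (κ ×ₖ κ') with hM
  have hinv : ∀ t, ∫⁻ q, edist q.2.1 q.2.2 ∂M
      = ∫⁻ q, edist (φ t q.1 q.2.1) (φ t q.1 q.2.2) ∂M := by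
    intro t
    rw [hM, Measure.lintegral_compProd
      (f := fun q : Ω × UnitAddCircle × UnitAddCircle => edist q.2.1 q.2.2)
      (hed.comp measurable_snd), Measure.lintegral_compProd (hmeas t)]
    have hF : Measurable fun ω => ∫⁻ z, edist z.1 z.2 ∂((κ ×ₖ κ') ω) := hed.lintegral_kernel
    rw [← (hθ t).lintegral_comp hF]
    refine lintegral_congr_ae ?_
    filter_upwards [hκ.kernel_equivariant hφ hA hθ t, hκ'.kernel_equivariant hφ hA hθ t]
      with ω h1 h2
    have hc : Measurable (φ t ω) := (φ t ω).continuous.measurable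
    simp only [Kernel.prod_apply]
    rw [h1, h2, Measure.map_prod_map _ _ hc hc, lintegral_map hed (hc.prodMap hc)]
    rfl
  have hlim : Tendsto (fun n => ∫⁻ q, edist (φ (τ n) q.1 q.2.1) (φ (τ n) q.1 q.2.2) ∂M) atTop
      (𝓝 (∫⁻ _, 0 ∂M)) := by
    refine tendsto_lintegral_of_dominated_convergence (fun _ => 1) (fun n => hmeas _)
      (fun n => ae_of_all _ fun q => ?_) (by simp [hM]) ?_
    · change edist _ _ ≤ (1 : ENNReal)
      rw [edist_dist, ← ENNReal.ofReal_one]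
      refine ENNReal.ofReal_le_ofReal ?_
      rw [dist_eq_norm]
      refine (AddCircle.norm_le_half_period 1 one_ne_zero).trans (by norm_num)
    · refine Measure.ae_compProd_of_ae_ae (measurableSet_tendsto _ fun n => hmeas _) ?_
      filter_upwards [hrc, Measure.ae_ae_of_ae_compProd h, Measure.ae_ae_of_ae_compProd h']
        with ω hω h1 h2
      rw [Kernel.prod_apply]
      filter_upwards [Measure.quasiMeasurePreserving_fst.ae h1,
        Measure.quasiMeasurePreserving_snd.ae h2] with z hz1 hz2
      have := (ENNReal.continuous_ofReal.tendsto 0).comp ((hω.tendsto_dist hz1 hz2).comp hτ)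
      simpa [edist_dist, Function.comp_def] using this
  have hzero : ∫⁻ q, edist q.2.1 q.2.2 ∂M = 0 := by
    simp_rw [← hinv, lintegral_zero] at hlim
    exact tendsto_nhds_unique tendsto_const_nhds hlim
  have hae := (lintegral_eq_zero_iff (hed.comp measurable_snd)).1 hzero
  filter_upwards [Measure.ae_ae_of_ae_compProd hae] with ω hω
  rw [Kernel.prod_apply] at hω
  filter_upwards [Measure.ae_ae_of_ae_prod hω] with x hx
  filter_upwards [hx] with y hy
  exact edist_eq_zero.1 hy

/-- All invariant measures that do not charge the crack point agree, and are a random Dirac mass. -/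
theorem exists_forall_eq_randomDirac (hφ : IsRDS ℱ θ φ) (hA : IsTwoSided θ)
    (hθ : ∀ t, MeasurePreserving (θ t) P P) {τ : ℕ → T} (hτ : Tendsto τ atTop atTop)
    {r : Ω → UnitAddCircle} (hrc : ∀ᵐ ω ∂P, IsCrackPoint φ ω (r ω))
    (hν : IsInvariantMeasure P θ φ ν) (h : ∀ᵐ p ∂ν, p.2 ≠ r p.1) :
    ∃ a : Ω → UnitAddCircle, Measurable a ∧ ∀ ν', IsInvariantMeasure P θ φ ν' →
      (∀ᵐ p ∂ν', p.2 ≠ r p.1) → ν' = randomDirac P a := by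
  obtain ⟨κ, hκ, rfl⟩ := hν.exists_kernel
  -- Comparing the measure with itself: two independent samples from a fibre agree, so the fibre is
  -- a Dirac mass.
  obtain ⟨a, ha, hκa⟩ := exists_measurable_ae_eq_dirac (P := P) κ (by
    filter_upwards [ae_eq_of_invariant_off_crackPoint hφ hA hθ hτ hrc hν hν h h] with ω hω
    obtain ⟨x, hx⟩ := hω.exists
    exact ⟨x, eq_dirac_of_ae_eq hx⟩)
  refine ⟨a, ha, fun ν' hν' h' => ?_⟩
  obtain ⟨κ', hκ', rfl⟩ := hν'.exists_kernel
  have hae : ∀ᵐ p ∂(P ⊗ₘ κ'), p.2 = a p.1 := by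
    refine Measure.ae_compProd_of_ae_ae (measurableSet_graph ha) ?_
    filter_upwards [ae_eq_of_invariant_off_crackPoint hφ hA hθ hτ hrc hν hν' h h', hκa]
      with ω h1 h2
    rw [h2, ae_dirac_eq, eventually_pure] at h1
    filter_upwards [h1] with y hy using hy.symm
  rw [eq_map_of_ae_eq_graph ha hae, hν'.map_fst, randomDirac]

end Disintegration

end CircleRDS

namespace CircleRDS

/-! ### Measurability with respect to the past -/

section Past

variable {Ω : Type*} {m : MeasurableSpace Ω} {T : AddSubmonoid ℝ≥0} {P : Measure Ω}
  {φ : T → Ω → UnitAddCircle ≃ₜ UnitAddCircle} {θ : T → Ω → Ω} {ℱ : Filtration T m}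

theorem pastSigma_le (hA : IsTwoSided θ) : pastSigma ℱ θ ≤ m := by
  refine MeasurableSpace.generateFrom_le ?_
  rintro _ ⟨t, E, hE, rfl⟩
  exact (hA.measurableEmbedding t).measurableSet_image.2 (ℱ.le t E hE)

/-- The law of `r` has at most countably many atoms, while the circle is uncountable. -/
theorem exists_forall_ae_ne [IsProbabilityMeasure P] {r : Ω → UnitAddCircle}
    (hr : Measurable r) : ∃ x, ∀ᵐ ω ∂P, x ≠ r ω := by
  have hc : {x : UnitAddCircle | 0 < P {ω | r ω = x}}.Countable :=
    Measure.countable_meas_level_set_pos hr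
  have hu : ¬ (Set.univ : Set UnitAddCircle).Countable := by
    intro h
    have : Countable UnitAddCircle := Set.countable_univ_iff.1 h
    have h1 : (Set.Ico (0 : ℝ) (0 + 1)).Countable :=
      Set.countable_coe_iff.1 (AddCircle.equivIco 1 0).symm.injective.countable
    simpa using h1.measure_zero volume
  obtain ⟨x, hx⟩ := (Set.ne_univ_iff_exists_notMem _).1 (fun h => hu (h ▸ hc))
  refine ⟨x, ?_⟩
  have : P {ω | r ω = x} = 0 := by simpa using hx
  filter_upwards [measure_eq_zero_iff_ae_notMem.1 this] with ω hω h
  exact hω h.symm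

/-- A random fixed point away from the crack point is the limit in probability of the images of a
deterministic point under the flow started in the remote past. -/
theorem exists_pastSigma_measurable_ae_eq [IsProbabilityMeasure P] (hφ : IsRDS ℱ θ φ)
    (hA : IsTwoSided θ) (hθ : ∀ t, MeasurePreserving (θ t) P P) {τ : ℕ → T}
    (hτ : Tendsto τ atTop atTop) {r : Ω → UnitAddCircle} (hr : Measurable r)
    (hrc : ∀ᵐ ω ∂P, IsCrackPoint φ ω (r ω)) {a : Ω → UnitAddCircle}
    (ha : IsRandomFixedPoint P θ φ a) (har : ∀ᵐ ω ∂P, a ω ≠ r ω) :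
    ∃ a' : Ω → UnitAddCircle, Measurable[pastSigma ℱ θ] a' ∧ a =ᵐ[P] a' := by
  obtain ⟨x, hx⟩ := exists_forall_ae_ne (P := P) hr
  choose e he using hA
  -- The position at time `0` of the trajectory started from `x` at time `-τ n`.
  let f : ℕ → Ω → UnitAddCircle := fun n ω => φ (τ n) ((e (τ n)).symm ω) x
  have hf : ∀ n, Measurable[pastSigma ℱ θ] (f n) := by
    intro n s hs
    refine MeasurableSpace.measurableSet_generateFrom
      ⟨τ n, (fun ω => φ (τ n) ω x) ⁻¹' s, hφ.measurable_apply (τ n) x hs, ?_⟩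
    rw [← funext (he (τ n)), (e (τ n)).image_eq_preimage_symm]
    rfl
  have hfm : ∀ n, Measurable (f n) := fun n =>
    (hf n).mono (pastSigma_le fun t => ⟨e t, he t⟩) le_rfl
  let g : ℕ → Ω → ℝ := fun n ω => dist (φ (τ n) ω x) (φ (τ n) ω (a ω))
  have hgm : ∀ n, Measurable (g n) := fun n =>
    ((hφ.measurable_apply (τ n) x).mono (ℱ.le _) le_rfl).dist
      ((hφ.measurable_uncurry (τ n)).comp (measurable_id.prodMk ha.measurable))
  have hg : TendstoInMeasure P g atTop (fun _ => 0) := by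
    refine tendstoInMeasure_of_tendsto_ae (fun n => (hgm n).aestronglyMeasurable) ?_
    filter_upwards [hrc, hx, har] with ω h1 h2 h3
    exact (h1.tendsto_dist h2 h3).comp hτ
  have hfa : TendstoInMeasure P f atTop a := by
    -- Shifting by the measure-preserving `θ (τ n)` turns the distance from `f n` to `a` into `g n`.
    -- Only the law is preserved, so the convergence is in probability, and an a.e. convergent
    -- subsequence is extracted afterwards.
    intro ε hε
    refine (hg ε hε).congr fun n => ?_
    rw [← (hθ (τ n)).measure_preimage
      (measurableSet_le measurable_const ((hfm n).edist ha.measurable)).nullMeasurableSet]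
    refine measure_congr ?_
    filter_upwards [ha.fixed (τ n)] with ω hω
    have h1 : f n (θ (τ n) ω) = φ (τ n) ω x := by
      simp only [f]
      rw [← he, MeasurableEquiv.symm_apply_apply]
    have h2 : edist (g n ω) 0 = edist (f n (θ (τ n) ω)) (a (θ (τ n) ω)) := by
      rw [h1, ← hω, edist_dist, edist_dist, Real.dist_0_eq_abs, abs_of_nonneg dist_nonneg]
    exact congrArg (ε ≤ ·) h2
  obtain ⟨ns, -, hns⟩ := hfa.exists_seq_tendsto_ae
  refine ⟨fun ω => limUnder atTop fun i => f (ns i) ω,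
    measurable_limUnder fun i => hf (ns i), ?_⟩
  filter_upwards [hns] with ω hω
  exact hω.limUnder_eq.symm

end Past

end CircleRDS

/-! ### The dichotomy -/

open CircleRDS

theorem theorem5p10 {Ω : Type*} {m : MeasurableSpace Ω} (P : Measure Ω) [IsProbabilityMeasure P]
    (T : AddSubmonoid ℝ≥0) (hT : CircleRDS.IsTimeSet T)
    (ℱ : Filtration T m) (θ : T → Ω → Ω) (hθ : CircleRDS.IsMemorylessNoise P ℱ θ)
    (hA : CircleRDS.IsTwoSided θ) (hB : CircleRDS.IsErgodicFlow P θ)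
    (φ : T → Ω → UnitAddCircle ≃ₜ UnitAddCircle) (hφ : CircleRDS.IsRDS ℱ θ φ)
    (hc : ∀ᵐ ω ∂P, ω ∈ CircleRDS.contractiveSet φ)
    (r : Ω → UnitAddCircle) (hr : Measurable r)
    (hrc : ∀ ω ∈ CircleRDS.contractiveSet φ, CircleRDS.IsCrackPoint φ ω (r ω)) :
    CircleRDS.IsRandomFixedPoint P θ φ r ∧
    (∃ r' : Ω → UnitAddCircle, Measurable[CircleRDS.futureSigma ℱ] r' ∧ r' =ᵐ[P] r) ∧
    ({μ | CircleRDS.IsInvariantMeasure P θ φ μ} = {CircleRDS.randomDirac P r} ∨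
      ∃ a : Ω → UnitAddCircle,
        Measurable[CircleRDS.pastSigma ℱ θ] a ∧
        CircleRDS.IsRandomFixedPoint P θ φ a ∧
        (∀ᵐ ω ∂P, a ω ≠ r ω) ∧
        {μ | CircleRDS.IsInvariantMeasure P θ φ μ} =
          {μ | ∃ c ∈ Set.Icc (0 : ℝ) 1,
            μ = ENNReal.ofReal c • CircleRDS.randomDirac P r +
              ENNReal.ofReal (1 - c) • CircleRDS.randomDirac P a}) := by
  have hmp := hθ.measurePreserving
  obtain ⟨τ, hτ⟩ := hT.exists_tendsto_atTop
  have hrc' : ∀ᵐ ω ∂P, IsCrackPoint φ ω (r ω) := hc.mono fun ω hω => hrc ω hω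
  have hfix : IsRandomFixedPoint P θ φ r := ⟨hr, fun t => by
    filter_upwards [hrc'] with ω hω
    exact (hω.map hφ t).eq (hrc _ ⟨_, hω.map hφ t⟩)⟩
  have hδr := hfix.isInvariantMeasure hφ hmp
  refine ⟨hfix, ?_, ?_⟩
  · obtain ⟨r', hr', h⟩ := exists_measurable_eq_crackPoint (m' := futureSigma ℱ) hτ
      (fun n x => (hφ.measurable_apply (τ n) x).mono (le_iSup (fun t => ℱ t) (τ n)) le_rfl)
    exact ⟨r', hr', hrc'.mono fun ω hω => h ω _ hω⟩
  have hG := measurableSet_graph hr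
  set G := {p : Ω × UnitAddCircle | p.2 = r p.1}
  have hGinv : ∀ μ, IsInvariantMeasure P θ φ μ → ∀ t, skewProduct θ φ t ⁻¹' G =ᵐ[μ] G := by
    intro μ hμ t
    have h1 : ∀ᵐ p ∂μ, φ t p.1 (r p.1) = r (θ t p.1) := by
      have h := hfix.fixed t
      rw [← hμ.map_fst] at h
      exact ae_of_ae_map measurable_fst.aemeasurable h
    filter_upwards [h1] with p hp
    change (φ t p.1 p.2 = r (θ t p.1)) = (p.2 = r p.1)
    rw [← hp, (φ t p.1).injective.eq_iff]
  have hdecomp : ∀ μ, IsInvariantMeasure P θ φ μ →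
      μ = μ G • randomDirac P r + μ.restrict Gᶜ := by
    intro μ hμ
    conv_lhs => rw [← Measure.restrict_add_restrict_compl (μ := μ) hG]
    congr 1
    have hGr : ∀ᵐ p ∂(μ.restrict G), p.2 = r p.1 := ae_restrict_mem hG
    rw [eq_map_of_ae_eq_graph hr hGr, hμ.map_fst_restrict hB hA hmp hG
      (hGinv μ hμ), Measure.map_smul, randomDirac]
  -- Alternative (B) holds exactly when some invariant measure charges the complement of the graph
  -- of `r`.
  by_cases hex : ∃ μ, IsInvariantMeasure P θ φ μ ∧ μ Gᶜ ≠ 0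
  · right
    have hnorm : ∀ μ, IsInvariantMeasure P θ φ μ → μ Gᶜ ≠ 0 →
        IsInvariantMeasure P θ φ ((μ Gᶜ)⁻¹ • μ.restrict Gᶜ) ∧
          ∀ᵐ p ∂((μ Gᶜ)⁻¹ • μ.restrict Gᶜ), p.2 ≠ r p.1 := fun μ hμ h0 =>
      ⟨hμ.normalized_restrict hB hA hmp hG.compl (fun t => (hGinv μ hμ t).compl) h0,
        Measure.ae_smul_measure (ae_restrict_mem hG.compl) _⟩
    obtain ⟨μ₀, hμ₀, h0⟩ := hex
    obtain ⟨hν, hνr⟩ := hnorm μ₀ hμ₀ h0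
    obtain ⟨b, hb, huniq⟩ := exists_forall_eq_randomDirac hφ hA hmp hτ hrc' hν hνr
    have hνb := huniq _ hν hνr
    rw [hνb] at hν hνr
    have hbfix := isRandomFixedPoint_of_isInvariantMeasure hb hν
    have hbr : ∀ᵐ ω ∂P, b ω ≠ r ω :=
      ae_of_ae_map (f := fun ω => (ω, b ω)) (measurable_id.prodMk hb).aemeasurable hνr
    -- The atom `b` of the fibres is only measurable for `m`; `a` is its past-measurable version.
    obtain ⟨a, ha, hba⟩ := exists_pastSigma_measurable_ae_eq hφ hA hmp hτ hr hrc' hbfix hbr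
    have hafix := hbfix.congr hmp (ha.mono (pastSigma_le hA) le_rfl) hba
    refine ⟨a, ha, hafix, ?_, ?_⟩
    · filter_upwards [hbr, hba] with ω h1 h2
      rwa [← h2]
    rw [← randomDirac_congr hba]
    ext μ
    constructor
    · intro hμ
      have hμ : IsInvariantMeasure P θ φ μ := hμ
      have := hμ.isProbabilityMeasure
      refine ⟨(μ G).toReal, ⟨ENNReal.toReal_nonneg, ENNReal.toReal_le_of_le_ofReal zero_le_one
        (by simpa using prob_le_one)⟩, ?_⟩
      have h1 : ENNReal.ofReal (1 - (μ G).toReal) = μ Gᶜ := by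
        rw [prob_compl_eq_one_sub hG, ENNReal.ofReal_sub _ ENNReal.toReal_nonneg,
          ENNReal.ofReal_one, ENNReal.ofReal_toReal (measure_ne_top _ _)]
      rw [h1, ENNReal.ofReal_toReal (measure_ne_top _ _)]
      conv_lhs => rw [hdecomp μ hμ]
      congr 1
      by_cases h0 : μ Gᶜ = 0
      · rw [h0, zero_smul, Measure.restrict_eq_zero.2 h0]
      · obtain ⟨h2, h3⟩ := hnorm μ hμ h0
        rw [← huniq _ h2 h3, smul_smul, ENNReal.mul_inv_cancel h0 (measure_ne_top _ _), one_smul]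
    · rintro ⟨c, ⟨hc0, hc1⟩, rfl⟩
      refine hδr.smul_add_smul hν ?_
      rw [← ENNReal.ofReal_add hc0 (by linarith)]
      simp
  · left
    refine Set.Subset.antisymm (fun μ hμ => ?_) (Set.singleton_subset_iff.2 hδr)
    have hμ : IsInvariantMeasure P θ φ μ := hμ
    have := hμ.isProbabilityMeasure
    have h0 : μ Gᶜ = 0 := by
      by_contra h
      exact hex ⟨μ, hμ, h⟩
    have h1 := hdecomp μ hμ
    rw [Measure.restrict_eq_zero.2 h0, add_zero, (prob_compl_eq_zero_iff hG).1 h0, one_smul] at h1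
    exact h1
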